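/- Let $(X,\mu)$ be a nonempty, bounded, complete metric space and let $D$ be a finite set of contractions of $X$ (digits) with $\bigcup_{d\in D} d[X]=X$; a finite sequence $[d_0,\dots,d_{n-1}]\in D^n$ is identified with the map $d_0\circ\cdots\circ d_{n-1}$. Let $Q=\{u_0,u_1,\dots\}$ be a dense subset of $X$ (with a fixed enumeration) such that $\{(i,j,r) : \mu(u_i,u_j)<r\}$ and $\{(i,j,r):\mu(u_i,u_j)>r\}$ ($i,j\in\mathbb N$, $r\in\mathbb Q$) are computably enumerable, and suppose that each $d\in D$ is computable, i.e. has a computable modulus of uniform continuity and, given $u\in Q$ and $n\in\mathbb N$, one can compute $v\in Q$ with $\mu(d(u),v)<2^{-n}$. (Elements of $Q$ are handled through their indices, finite subsets of $Q$ through finite lists of indices.) Assume that * (well-covering) every $x\in X$ lies in the interior of $d[X]$ for some $d\in D$; * (decidable) for $u\in Q$, $\theta\in\mathbb Q_+$, $d\in D$ it is decidable whether the open ball $B(u,\theta)$ is contained in $d[X]$; * (approximable choice) for every $d\in D$ there is an effective procedure $(\theta,u)\mapsto v^\theta_u$ from $\mathbb Q_+\times(d[X]\cap Q)$ to $Q$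 such that (1) $\mu(v^\theta_u,v^{\bar\theta}_u)<\max\{\theta,\bar\theta\}$ for all $u$ and $\theta,\bar\theta$; (2) from $\theta$ one can compute $\theta'\in\mathbb Q_+$ such that $\mu(u,u')<\theta'$ implies $\mu(v^\theta_u,v^\theta_{u'})<\theta$ for all $u,u'\in d[X]\cap Q$; (3) for all $\theta$ and $u$ there is $z\in d^{-1}[\{u\}]$ with $\mu(z,v^\theta_u)<\theta$. Let $\mathcal T_D$ be the set of digital trees, i.e. of sets $T\subseteq D^{<\omega}$ that contain $[]$, are closed under prefixes and have no maximal element (a tree being given by its characteristic function), and let $[\![T]\!]=\bigcap_{n}\bigcup\{\vec d[X] : \vec d\in T\cap D^n\}$ be the value of $T$. Let $\mathcal Q$ be the set of nonempty finite subsets of $Q$ and let $\eta_{\mathrm H}$ be the Hausdorff representation of the set $\mathrm K(X)$ of nonempty compact subsets of $X$: for $w\in\mathcal Q^\omega$ and $K\in \mathrm K(X)$, $\eta_{\mathrm H}(w)=K$ if and only if $\mu_{\mathrm H}(w_n,K)<2^{-n}$ for all $n\in\mathbb N$, where $\mu_{\mathrm H}$ is the Hausdorff metric. Then there are computable operators $H:\mathcal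 T_D\to\mathcal Q^\omega$ and $J:\subseteq\mathcal Q^\omega\to\mathcal T_D$ with $\operatorname{dom}(J)=\operatorname{dom}(\eta_{\mathrm H})$ such that $$\eta_{\mathrm H}(H(T))=[\![T]\!]\quad\text{and}\quad [\![J(w)]\!]=\eta_{\mathrm H}(w)$$ for all $T\in\mathcal T_D$ and all $w\in\operatorname{dom}(J)$. In particular $[\![J(H(T))]\!]=[\![T]\!]$ and $\eta_{\mathrm H}(H(J(w)))=\eta_{\mathrm H}(w)$. -/

import Mathlib

/-! ### Digit spaces and digital trees -/

namespace DigitSpace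

/-- `(X, {d a | a : Fin k})` is a digit space: `X` is a nonempty, bounded, complete metric space,
and the finitely many maps `d a` are contractions whose ranges cover `X`. The index `a : Fin k`
is the letter that stands for the digit `d a`. -/
structure IsDigitSpace {X : Type*} [MetricSpace X] {k : ℕ} (d : Fin k → X → X) : Prop where
  nonempty : Nonempty X
  complete : CompleteSpace X
  bounded : ∃ M : ℝ, ∀ x y : X, dist x y ≤ M
  contraction : ∀ a, ∃ q : ℝ, q < 1 ∧ ∀ x y : X, dist (d a x) (d a y) ≤ q * dist x y
  cover : ∀ x : X, ∃ a, x ∈ Set.range (d a)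

/-- The composition `d a₀ ∘ ⋯ ∘ d aₙ₋₁` denoted by the word `[a₀, …, aₙ₋₁]`. -/
def wordMap {X : Type*} {k : ℕ} (d : Fin k → X → X) (l : List (Fin k)) (x : X) : X :=
  l.foldr (fun a y => d a y) x

/-- A digital tree: a set of words over the digits (given by its characteristic function `mem`)
that contains the empty word, is closed under prefixes and has no maximal element. -/
structure DigitalTree (k : ℕ) where
  mem : List (Fin k) → Bool
  nil_mem : mem [] = true
  prefix_mem : ∀ l a, mem (l ++ [a]) = true → mem l = true
  exists_succ : ∀ l, mem l = true → ∃ a, mem (l ++ [a]) = true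

/-- The value `⋂ₙ ⋃ {l[X] | l ∈ T, l of length n}` of a digital tree `T`. -/
def DigitalTree.value {X : Type*} {k : ℕ} (d : Fin k → X → X) (T : DigitalTree k) : Set X :=
  ⋂ n : ℕ, ⋃ l ∈ {l : List (Fin k) | l.length = n ∧ T.mem l = true}, Set.range (wordMap d l)

/-! ### Computable digit spaces

The countable dense set `Q` is given by an enumeration `u : ℕ → X` (repetitions allowed), and a
basic element `u i` is handled through its index `i`. -/

/-- The rational number with code `(a, b, c)`. -/
def ratOf (r : ℕ × ℕ × ℕ) : ℚ := ((r.1 : ℚ) - r.2.1) / (r.2.2 + 1)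

/-- The positive rational number with code `(a, b)`. -/
def posRatOf (r : ℕ × ℕ) : ℚ := ((r.1 : ℚ) + 1) / (r.2 + 1)

/-- `(X, {u i})` is a computable metric space. -/
structure IsComputableMetric {X : Type*} [MetricSpace X] (u : ℕ → X) : Prop where
  dense : DenseRange u
  lt_re : REPred fun p : ℕ × ℕ × (ℕ × ℕ × ℕ) => dist (u p.1) (u p.2.1) < (ratOf p.2.2 : ℝ)
  gt_re : REPred fun p : ℕ × ℕ × (ℕ × ℕ × ℕ) => (ratOf p.2.2 : ℝ) < dist (u p.1) (u p.2.1)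

/-- A computable map `X → X`: it has a computable modulus of (uniform) continuity, and its values
at basic elements can be computed to any precision. -/
structure IsComputableMap {X : Type*} [MetricSpace X] (u : ℕ → X) (f : X → X) : Prop where
  modulus : ∃ m : ℕ → ℕ, Computable m ∧
    ∀ n x y, dist x y < (1 / 2 : ℝ) ^ m n → dist (f x) (f y) < (1 / 2 : ℝ) ^ n
  approx : ∃ g : ℕ → ℕ → ℕ, Computable₂ g ∧
    ∀ i n, dist (f (u i)) (u (g i n)) < (1 / 2 : ℝ) ^ n

/-- `(X, {d a}, {u i})` is a computable digit space. -/
structure IsComputableDigitSpace {X : Type*} [MetricSpace X] {k : ℕ}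
    (d : Fin k → X → X) (u : ℕ → X) : Prop where
  digitSpace : IsDigitSpace d
  computableMetric : IsComputableMetric u
  computableDigit : ∀ a, IsComputableMap u (d a)

/-- Every point lies in the interior of `d a [X]` for some digit `d a`. -/
def IsWellCovering {X : Type*} [MetricSpace X] {k : ℕ} (d : Fin k → X → X) : Prop :=
  ∀ x : X, ∃ a, x ∈ interior (Set.range (d a))

/-- It can be decided, for a basic element `u i`, a positive rational `θ` and a digit `d a`,
whether the open ball of radius `θ` around `u i` is contained in `d a [X]`. -/
def IsDecidable {X : Type*} [MetricSpace X] {k : ℕ} (d : Fin k → X → X) (u : ℕ → X) : Prop :=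
  ComputablePred fun p : ℕ × (ℕ × ℕ) × Fin k =>
    Metric.ball (u p.1) (posRatOf p.2.1 : ℝ) ⊆ Set.range (d p.2.2)

/-- Approximable choice. For each digit `d a` there is a procedure `(θ, i) ↦ v θ i`, which has to
terminate (and whose values are used) only if `u i ∈ d a [X]`; the map `t` computes `θ'` from
`θ`. -/
def HasApproximableChoice {X : Type*} [MetricSpace X] {k : ℕ}
    (d : Fin k → X → X) (u : ℕ → X) : Prop :=
  ∀ a, ∃ v : ℕ × ℕ → ℕ → ℕ,
    (∃ φ : (ℕ × ℕ) × ℕ →. ℕ, Partrec φ ∧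
      ∀ θ i, u i ∈ Set.range (d a) → v θ i ∈ φ (θ, i)) ∧
    (∀ θ θ' i, u i ∈ Set.range (d a) →
      dist (u (v θ i)) (u (v θ' i)) < max (posRatOf θ : ℝ) (posRatOf θ' : ℝ)) ∧
    (∃ t : ℕ × ℕ → ℕ × ℕ, Computable t ∧
      ∀ θ i j, u i ∈ Set.range (d a) → u j ∈ Set.range (d a) →
        dist (u i) (u j) < (posRatOf (t θ) : ℝ) →
        dist (u (v θ i)) (u (v θ j)) < (posRatOf θ : ℝ)) ∧
    (∀ θ i, u i ∈ Set.range (d a) →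
      ∃ z, d a z = u i ∧ dist z (u (v θ i)) < (posRatOf θ : ℝ))

/-! ### The Hausdorff representation of compact sets -/

/-- The finite set of basic elements whose indices are listed in `l`. Nonempty lists are the
codes of basic sets. -/
def basicSet {X : Type*} (u : ℕ → X) (l : List ℕ) : Set X := u '' {i | i ∈ l}

/-- `η_H(w) = K`: the set `K` is nonempty and compact, and `w` is a sequence of (codes of) basic
sets with `μ_H(wₙ, K) < 2⁻ⁿ` for all `n`. -/
def HausdorffRep {X : Type*} [MetricSpace X] (u : ℕ → X) (w : ℕ → List ℕ) (K : Set X) : Prop :=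
  K.Nonempty ∧ IsCompact K ∧
    ∀ n, w n ≠ [] ∧ Metric.hausdorffDist (basicSet u (w n)) K < (1 / 2 : ℝ) ^ n

/-! ### Computable operators on function spaces -/

/-- `φ` computes `r : γ → δ` from the oracle `p : α → β`: given `c` and finitely many values of
`p`, listed in `L`, the procedure `φ` can only output `r c`, and it does output `r c` for some
finite list of values of `p`. -/
def ComputesFrom {α β γ δ : Type*} (φ : List (α × β) × γ →. δ) (p : α → β) (r : γ → δ) : Prop :=
  ∀ c y, r c = y ↔ ∃ L : List (α × β), (∀ e ∈ L, p e.1 = e.2) ∧ y ∈ φ (L, c)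

/-- A partial operator `F` from `A` to `B`, whose arguments and values are given by functions
`nA x : α → β` and `nB y : γ → δ`, is computable if a single partial recursive procedure computes
the value from the argument, for all arguments in the domain of `F`. -/
def IsComputableOperator {A B α β γ δ : Type*}
    [Primcodable α] [Primcodable β] [Primcodable γ] [Primcodable δ]
    (nA : A → α → β) (nB : B → γ → δ) (F : A →. B) : Prop :=
  ∃ φ : List (α × β) × γ →. δ, Partrec φ ∧
    ∀ x, ∀ y ∈ F x, ComputesFrom φ (nA x) (nB y)

end DigitSpace

namespace Computable

variable {α β γ σ τ : Type*} [Primcodable α] [Primcodable β] [Primcodable γ] [Primcodable σ]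
  [Primcodable τ]

theorem list_foldl {f : α → List β} {g : α → σ} {h : α → σ × β → σ}
    (hf : Computable f) (hg : Computable g) (hh : Computable₂ h) :
    Computable fun a => (f a).foldl (fun s b => h a (s, b)) (g a) := by
  have step : Computable₂ fun (a : α) (p : ℕ × σ) =>
      (((f a)[p.1]?).map fun b => h a (p.2, b)).getD p.2 := by
    refine option_getD (option_map (list_getElem?.comp (hf.comp fst) (fst.comp snd)) ?_)
      (snd.comp snd)
    exact hh.comp (fst.comp fst) (pair (snd.comp (snd.comp fst)) snd)
  refine (nat_rec (list_length.comp hf) hg step).of_eq fun a => ?_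
  have key : ∀ n, n ≤ (f a).length →
      (Nat.rec (g a) (fun n s => (((f a)[n]?).map fun b => h a (s, b)).getD s) n : σ) =
        ((f a).take n).foldl (fun s b => h a (s, b)) (g a) := by
    intro n hn
    induction n with
    | zero => simp
    | succ n ih =>
      have hlt : n < (f a).length := hn
      simp only [ih hlt.le, List.getElem?_eq_getElem hlt, Option.map_some, Option.getD_some]
      rw [List.take_add_one, List.getElem?_eq_getElem hlt, List.foldl_append]
      rfl
  simpa using key _ le_rfl

theorem list_foldr {f : α → List β} {g : α → σ} {h : α → β × σ → σ}
    (hf : Computable f) (hg : Computable g) (hh : Computable₂ h) :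
    Computable fun a => (f a).foldr (fun b s => h a (b, s)) (g a) := by
  refine (list_foldl (h := fun a p => h a (p.2, p.1)) (list_reverse.comp hf) hg ?_).of_eq
    fun a => by rw [List.foldl_reverse]
  exact hh.comp fst (pair (snd.comp snd) (fst.comp snd))

theorem list_flatMap {f : α → List β} {g : α → β → List σ}
    (hf : Computable f) (hg : Computable₂ g) : Computable fun a => (f a).flatMap (g a) := by
  refine (list_foldr (g := fun _ => []) (h := fun a p => g a p.1 ++ p.2) hf (const _) ?_).of_eq
    fun a => ?_
  · exact list_append.comp (hg.comp fst (fst.comp snd)) (snd.comp snd)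
  · induction f a with
    | nil => rfl
    | cons b l ih => simp [ih]

theorem list_map {f : α → List β} {g : α → β → σ}
    (hf : Computable f) (hg : Computable₂ g) : Computable fun a => (f a).map (g a) :=
  (list_flatMap (g := fun a b => [g a b]) hf (list_cons.comp hg (const []))).of_eq fun a => by
    rw [List.map_eq_flatMap]

theorem list_all {f : α → List β} {g : α → β → Bool}
    (hf : Computable f) (hg : Computable₂ g) : Computable fun a => (f a).all (g a) := by
  refine (list_foldr (g := fun _ => true) (h := fun a p => bif g a p.1 then p.2 else false)
    hf (const _) ?_).of_eq fun a => ?_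
  · exact Computable.cond (hg.comp fst (fst.comp snd)) (snd.comp snd) (const false)
  · induction f a with
    | nil => rfl
    | cons b l ih => simp only [List.foldr_cons, ih, List.all_cons]; cases g a b <;> simp

theorem list_any {f : α → List β} {g : α → β → Bool}
    (hf : Computable f) (hg : Computable₂ g) : Computable fun a => (f a).any (g a) := by
  refine (list_foldr (g := fun _ => false) (h := fun a p => bif g a p.1 then true else p.2)
    hf (const _) ?_).of_eq fun a => ?_
  · exact Computable.cond (hg.comp fst (fst.comp snd)) (const true) (snd.comp snd)
  · induction f a with
    | nil => rfl
    | cons b l ih => simp only [List.foldr_cons, ih, List.any_cons]; cases g a b <;> simp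

theorem list_filter {f : α → List β} {g : α → β → Bool}
    (hf : Computable f) (hg : Computable₂ g) : Computable fun a => (f a).filter (g a) := by
  refine (list_flatMap (g := fun a b => bif g a b then [b] else []) hf ?_).of_eq fun a => ?_
  · exact Computable.cond hg (list_cons.comp snd (const [])) (const [])
  · induction f a with
    | nil => rfl
    | cons b l ih => simp only [List.flatMap_cons, ih, List.filter_cons]; cases g a b <;> simp

theorem list_range : Computable List.range :=
  Primrec.list_range.to_comp

theorem list_getD (d : α) : Computable₂ fun (l : List α) n => l.getD n d :=
  (Primrec.list_getD d).to_comp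

theorem list_head? : Computable (@List.head? α) :=
  Primrec.list_head?.to_comp

theorem list_zip {f : α → List β} {g : α → List γ} (hf : Computable f) (hg : Computable g) :
    Computable fun a => (f a).zip (g a) := by
  refine (list_flatMap (f := fun a => List.range (f a).length)
    (g := fun a n => (((f a)[n]?).bind fun b => ((g a)[n]?).map fun c => [(b, c)]).getD [])
    (list_range.comp (list_length.comp hf)) ?_).of_eq fun a => ?_
  · refine option_getD (option_bind (list_getElem?.comp (hf.comp fst) snd) ?_) (const [])
    refine option_map (list_getElem?.comp (hg.comp (fst.comp fst)) (snd.comp fst)) ?_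
    exact list_cons.comp (pair (snd.comp fst) snd) (const [])
  · generalize f a = l
    generalize g a = l'
    induction l generalizing l' with
    | nil => rfl
    | cons b l ih =>
      rw [List.length_cons, List.range_succ_eq_map, List.flatMap_cons, List.flatMap_map]
      cases l' with
      | nil => simp
      | cons c l' => simpa using ih l'

theorem list_sections : Computable (@List.sections α) := by
  refine (list_foldr (α := List (List α)) (f := id) (g := fun _ => [[]])
    (h := fun _ p => p.2.flatMap fun s => p.1.map fun x => x :: s) Computable.id (const _)
    ?_).of_eq fun L => ?_
  · refine list_flatMap (snd.comp snd) ?_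
    refine list_map (fst.comp (snd.comp fst)) ?_
    exact list_cons.comp snd (snd.comp fst)
  · induction L with
    | nil => rfl
    | cons l L ih => simp only [id, List.foldr_cons] at ih ⊢; rw [ih]; rfl

theorem fin_family {k : ℕ} {f : Fin k → α → σ} (hf : ∀ i, Computable (f i)) :
    Computable₂ f :=
  (vector_get.comp ((vector_ofFn hf).comp snd) fst).of_eq fun p => by simp

theorem nat_add : Computable₂ ((· + ·) : ℕ → ℕ → ℕ) := Primrec.nat_add.to_comp
theorem nat_sub : Computable₂ ((· - ·) : ℕ → ℕ → ℕ) := Primrec.nat_sub.to_comp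
theorem nat_mul : Computable₂ ((· * ·) : ℕ → ℕ → ℕ) := Primrec.nat_mul.to_comp
theorem nat_pow : Computable₂ ((· ^ ·) : ℕ → ℕ → ℕ) :=
  (Primrec₂.unpaired'.1 Nat.Primrec.pow).to_comp

theorem _root_.ComputablePred.exists_bool {P : α → Prop} (hP : ComputablePred P) :
    ∃ c : α → Bool, Computable c ∧ ∀ a, c a = true ↔ P a := by
  obtain ⟨_, hc⟩ := hP
  exact ⟨_, hc, fun a => by simp⟩

/-- A computable choice of one of finitely many alternatives, when one always applies. -/
theorem exists_fin_choice {k : ℕ} {P : α → Fin k → Prop}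
    (hP : ComputablePred fun p : α × Fin k => P p.1 p.2) (h : ∀ a, ∃ i, P a i) :
    ∃ f : α → Fin k, Computable f ∧ ∀ a, P a (f a) := by
  obtain ⟨c, hc, hcP⟩ := hP.exists_bool
  have hF : Computable fun a : α =>
      ((List.finRange k).filter fun i => c (a, i)).head? :=
    list_head?.comp (list_filter (const _) hc)
  have hs : ∀ a, (((List.finRange k).filter fun i => c (a, i)).head?).isSome := by
    intro a
    obtain ⟨i, hi⟩ := h a
    rw [Option.isSome_iff_ne_none, Ne, List.head?_eq_none_iff, List.filter_eq_nil_iff]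
    intro H
    exact H i (List.mem_finRange i) ((hcP (a, i)).2 hi)
  refine ⟨fun a => Option.get _ (hs a), ?_, fun a => ?_⟩
  · exact option_some_iff.1 (hF.of_eq fun a => by simp)
  · have := List.mem_of_head? (Option.some_get (hs a)).symm
    exact (hcP _).1 (List.mem_filter.1 this).2

/-- Two recursively enumerable predicates that cover everything can be told apart by a
computable Boolean function. -/
theorem exists_separator {P Q : α → Prop} (hP : REPred P) (hQ : REPred Q)
    (h : ∀ a, P a ∨ Q a) :
    ∃ c : α → Bool, Computable c ∧ ∀ a, (c a = true → P a) ∧ (c a = false → Q a) := by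
  obtain ⟨k, hk, H⟩ := Partrec.merge'
    (Partrec.map hP (const true).to₂) (Partrec.map hQ (const false).to₂)
  have hd : ∀ a, (k a).Dom := fun a => by
    rw [(H a).2]
    simpa [Part.assert] using h a
  refine ⟨fun a => (k a).get (hd a), hk.of_eq_tot fun a => Part.get_mem _, fun a => ?_⟩
  have := (H a).1 _ (Part.get_mem (hd a))
  constructor <;> intro h' <;> simpa [h', Part.mem_map_iff] using this

/-- A partial recursive function that is defined on a decidable set agrees on it with a
computable function. -/
theorem exists_extension {P : α → Prop} (hP : ComputablePred P) {φ : α →. σ} (hφ : Partrec φ)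
    (h : ∀ a, P a → (φ a).Dom) [Inhabited σ] :
    ∃ f : α → σ, Computable f ∧ ∀ a, P a → f a ∈ φ a := by
  obtain ⟨c, hc, hcP⟩ := hP.exists_bool
  have hg : Partrec fun a => bif c a then φ a else Part.some default :=
    Partrec.cond hc hφ (const default).partrec
  have hd : ∀ a, (bif c a then φ a else Part.some default).Dom := fun a => by
    cases ha : c a
    · simp
    · simpa using h a ((hcP a).1 ha)
  refine ⟨fun a => Part.get _ (hd a), hg.of_eq_tot fun a => Part.get_mem _, fun a ha => ?_⟩
  have := Part.get_mem (hd a)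
  simpa only [(hcP a).2 ha, cond_true] using this

end Computable

namespace DigitSpace

/-- An operator is computable if its values are computed from the answers to finitely many
queries, which do not depend on the argument. -/
theorem isComputableOperator_of_queries {A B α β γ δ : Type*}
    [Primcodable α] [Primcodable β] [Primcodable γ] [Primcodable δ]
    {nA : A → α → β} {nB : B → γ → δ} {F : A →. B}
    {Q : γ → List α} {G : γ → List β → δ} (hQ : Computable Q) (hG : Computable₂ G)
    (h : ∀ x, ∀ y ∈ F x, ∀ c, nB y c = G c ((Q c).map (nA x))) :
    IsComputableOperator nA nB F := by
  classical
  refine ⟨fun p => ((if p.1.map Prod.fst = Q p.2 then some (G p.2 (p.1.map Prod.snd))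
    else none : Option δ) : Part δ), ?_, ?_⟩
  · refine Computable.ofOption ?_
    have h1 : Computable fun p : List (α × β) × γ => decide (p.1.map Prod.fst = Q p.2) :=
      (Primrec.eq (α := List α)).decide.to_comp.comp (Computable.list_map Computable.fst
        (Computable.fst.comp Computable.snd).to₂) (hQ.comp Computable.snd)
    refine (Computable.cond h1 (Computable.option_some.comp (hG.comp Computable.snd
      (Computable.list_map Computable.fst (Computable.snd.comp Computable.snd).to₂)))
      (Computable.const none)).of_eq fun p => ?_
    by_cases hp : p.1.map Prod.fst = Q p.2 <;> simp [hp]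
  · intro x y hy c z
    rw [h x y hy c]
    constructor
    · rintro rfl
      refine ⟨(Q c).map fun a => (a, nA x a), ?_, ?_⟩
      · simp
      · simp [Function.comp_def]
    · rintro ⟨L, hL, hz⟩
      by_cases hq : L.map Prod.fst = Q c
      · simp only [hq, if_true] at hz
        have : L.map Prod.snd = (Q c).map (nA x) := by
          rw [← hq, List.map_map]
          exact List.map_congr_left fun e he => (hL e he).symm
        rw [this] at hz
        exact (Part.mem_some_iff.1 hz).symm
      · simp [hq] at hz

end DigitSpace

namespace DigitSpace

section Geometry

variable {X : Type*} {k : ℕ} {d : Fin k → X → X}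

theorem wordMap_append (d : Fin k → X → X) (l l' : List (Fin k)) (x : X) :
    wordMap d (l ++ l') x = wordMap d l (wordMap d l' x) := by
  simp [wordMap]

theorem range_wordMap_append_subset (d : Fin k → X → X) (l l' : List (Fin k)) :
    Set.range (wordMap d (l ++ l')) ⊆ Set.range (wordMap d l) := by
  rintro _ ⟨x, rfl⟩
  exact ⟨_, (wordMap_append d l l' x).symm⟩

theorem DigitalTree.mem_of_append (T : DigitalTree k) {l l' : List (Fin k)}
    (h : T.mem (l ++ l') = true) : T.mem l = true := by
  induction l' using List.reverseRecOn with
  | nil => simpa using h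
  | append_singleton l' a ih =>
    rw [← List.append_assoc] at h
    exact ih (T.prefix_mem _ _ h)

theorem DigitalTree.mem_value (T : DigitalTree k) {x : X} :
    x ∈ T.value d ↔ ∀ n, ∃ l, l.length = n ∧ T.mem l = true ∧ x ∈ Set.range (wordMap d l) := by
  simp [DigitalTree.value, and_assoc]

theorem DigitalTree.mem_value_of_le (T : DigitalTree k) {x : X}
    (h : ∀ n, ∃ l, n ≤ l.length ∧ T.mem l = true ∧ x ∈ Set.range (wordMap d l)) :
    x ∈ T.value d := by
  refine T.mem_value.2 fun n => ?_
  obtain ⟨l, hn, hl, hx⟩ := h n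
  rw [← List.take_append_drop n l] at hl hx
  exact ⟨l.take n, by simpa using hn, T.mem_of_append hl, range_wordMap_append_subset d _ _ hx⟩

variable [MetricSpace X]

theorem IsDigitSpace.exists_ratio (h : IsDigitSpace d) :
    ∃ q : ℝ, 0 ≤ q ∧ q < 1 ∧ ∀ a x y, dist (d a x) (d a y) ≤ q * dist x y := by
  choose q hq hd using h.contraction
  have key : ∀ s : Finset (Fin k), ∃ r : ℝ, 0 ≤ r ∧ r < 1 ∧ ∀ a ∈ s, q a ≤ r := by
    intro s
    induction s using Finset.induction_on with
    | empty => exact ⟨0, le_rfl, one_pos, by simp⟩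
    | insert a s _ ih =>
      obtain ⟨r, h0, h1, hr⟩ := ih
      refine ⟨max (q a) r, le_max_of_le_right h0, max_lt (hq a) h1, fun b hb => ?_⟩
      rcases Finset.mem_insert.1 hb with rfl | hb
      · exact le_max_left _ _
      · exact le_max_of_le_right (hr b hb)
  obtain ⟨r, h0, h1, hr⟩ := key Finset.univ
  exact ⟨r, h0, h1, fun a x y => (hd a x y).trans
    (mul_le_mul_of_nonneg_right (hr a (Finset.mem_univ a)) dist_nonneg)⟩

theorem IsDigitSpace.dist_le (h : IsDigitSpace d) (a : Fin k) (x y : X) :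
    dist (d a x) (d a y) ≤ dist x y := by
  obtain ⟨q, -, h1, hd⟩ := h.exists_ratio
  exact (hd a x y).trans (mul_le_of_le_one_left dist_nonneg h1.le)

theorem IsDigitSpace.continuous (h : IsDigitSpace d) (a : Fin k) : Continuous (d a) :=
  (LipschitzWith.of_dist_le_mul (K := 1) fun x y => by simpa using h.dist_le a x y).continuous

theorem IsDigitSpace.continuous_wordMap (h : IsDigitSpace d) (l : List (Fin k)) :
    Continuous (wordMap d l) := by
  induction l with
  | nil => exact continuous_id
  | cons a l ih => exact (h.continuous a).comp ih

/-- The diameters of the sets `l[X]` are at most `2⁻ⁿ` if `l` has length at least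
`s * (n + b)`. -/
theorem IsDigitSpace.exists_length (h : IsDigitSpace d) :
    ∃ s b : ℕ, ∀ n (l : List (Fin k)), s * (n + b) ≤ l.length →
      ∀ x y, dist (wordMap d l x) (wordMap d l y) ≤ (1 / 2 : ℝ) ^ n := by
  obtain ⟨q, h0, h1, hd⟩ := h.exists_ratio
  obtain ⟨M, hM⟩ := h.bounded
  obtain ⟨s, hs⟩ := exists_pow_lt_of_lt_one (one_half_pos (α := ℝ)) h1
  obtain ⟨b, hb⟩ := pow_unbounded_of_one_lt M (one_lt_two (α := ℝ))
  have hl : ∀ (l : List (Fin k)) x y,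
      dist (wordMap d l x) (wordMap d l y) ≤ q ^ l.length * dist x y := by
    intro l x y
    induction l with
    | nil => simp [wordMap]
    | cons a l ih =>
      calc _ ≤ q * dist (wordMap d l x) (wordMap d l y) := hd a _ _
        _ ≤ q * (q ^ l.length * dist x y) := mul_le_mul_of_nonneg_left ih h0
        _ = _ := by rw [List.length_cons]; ring
  refine ⟨s, b, fun n l hn x y => (hl l x y).trans ?_⟩
  calc q ^ l.length * dist x y ≤ (1 / 2 : ℝ) ^ (n + b) * 2 ^ b := by
        refine mul_le_mul ?_ ((hM x y).trans hb.le) dist_nonneg (by positivity)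
        calc q ^ l.length ≤ q ^ (s * (n + b)) := pow_le_pow_of_le_one h0 h1.le hn
          _ = (q ^ s) ^ (n + b) := pow_mul _ _ _
          _ ≤ _ := pow_le_pow_left₀ (pow_nonneg h0 _) hs.le _
    _ = (1 / 2 : ℝ) ^ n := by
        rw [pow_add, mul_assoc, ← mul_pow]; norm_num

theorem IsDigitSpace.exists_word (h : IsDigitSpace d) (n : ℕ) (x : X) :
    ∃ l : List (Fin k), l.length = n ∧ x ∈ Set.range (wordMap d l) := by
  induction n generalizing x with
  | zero => exact ⟨[], rfl, x, rfl⟩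
  | succ n ih =>
    obtain ⟨a, y, rfl⟩ := h.cover x
    obtain ⟨l, rfl, z, rfl⟩ := ih y
    exact ⟨a :: l, rfl, z, rfl⟩

theorem IsDigitSpace.compactSpace (h : IsDigitSpace d) : CompactSpace X := by
  have := h.complete
  obtain ⟨x₀⟩ := h.nonempty
  obtain ⟨s, b, hs⟩ := h.exists_length
  rw [← isCompact_univ_iff]
  refine isCompact_iff_totallyBounded_isComplete.2 ⟨?_, isComplete_univ⟩
  rw [Metric.totallyBounded_iff]
  intro ε hε
  obtain ⟨n, hn⟩ := exists_pow_lt_of_lt_one hε (one_half_lt_one (α := ℝ))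
  refine ⟨(fun l => wordMap d l x₀) '' {l : List (Fin k) | l.length = s * (n + b)},
    (List.finite_length_eq _ _).image _, fun x _ => ?_⟩
  obtain ⟨l, hl, y, rfl⟩ := h.exists_word (s * (n + b)) x
  simp only [Set.mem_iUnion]
  exact ⟨_, ⟨l, hl, rfl⟩, (hs n l hl.ge y x₀).trans_lt hn⟩

theorem DigitalTree.isClosed_value (hd : IsDigitSpace d) (T : DigitalTree k) :
    IsClosed (T.value d) := by
  have := hd.compactSpace
  refine isClosed_iInter fun n => Set.Finite.isClosed_biUnion ?_ fun l _ =>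
    (isCompact_range (hd.continuous_wordMap l)).isClosed
  exact (List.finite_length_eq _ n).subset fun l hl => hl.1

/-- If `l` is a node of the tree `T`, then `l[X]` meets the value of `T`. -/
theorem DigitalTree.exists_mem_value (hd : IsDigitSpace d) (T : DigitalTree k)
    {l : List (Fin k)} (hl : T.mem l = true) :
    ∃ x ∈ T.value d, x ∈ Set.range (wordMap d l) := by
  have := hd.compactSpace
  have := hd.nonempty
  obtain ⟨a₀, -⟩ := T.exists_succ l hl
  have : Nonempty (Fin k) := ⟨a₀⟩
  choose! a ha using T.exists_succ
  let f : ℕ → List (Fin k) := fun n => Nat.rec l (fun _ m => m ++ [a m]) n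
  have hf : ∀ n, f (n + 1) = f n ++ [a (f n)] := fun n => rfl
  have hmem : ∀ n, T.mem (f n) = true := by
    intro n
    induction n with
    | zero => exact hl
    | succ n ih => rw [hf]; exact ha _ ih
  have hlen : ∀ n, n ≤ (f n).length := by
    intro n
    induction n with
    | zero => simp
    | succ n ih => rw [hf]; simpa using ih
  obtain ⟨x, hx⟩ := IsCompact.nonempty_iInter_of_sequence_nonempty_isCompact_isClosed
    (fun n => Set.range (wordMap d (f n)))
    (fun n => by rw [hf]; exact range_wordMap_append_subset d _ _)
    (fun n => Set.range_nonempty _) (isCompact_range (hd.continuous_wordMap _))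
    (fun n => (isCompact_range (hd.continuous_wordMap _)).isClosed)
  rw [Set.mem_iInter] at hx
  exact ⟨x, T.mem_value_of_le fun n => ⟨f n, hlen n, hmem n, hx n⟩, hx 0⟩

theorem IsWellCovering.exists_ball_subset (hd : IsDigitSpace d) (h : IsWellCovering d) :
    ∃ δ > 0, ∀ x, ∃ a, Metric.ball x δ ⊆ Set.range (d a) := by
  have := hd.compactSpace
  obtain ⟨δ, hδ, H⟩ := lebesgue_number_lemma_of_metric (s := Set.univ)
    (c := fun a => interior (Set.range (d a))) isCompact_univ (fun _ => isOpen_interior)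
    fun x _ => Set.mem_iUnion.2 (h x)
  refine ⟨δ, hδ, fun x => ?_⟩
  obtain ⟨a, ha⟩ := H x (Set.mem_univ x)
  exact ⟨a, ha.trans interior_subset⟩

/-- A closed set is the value of a tree `T` if each of its points lies in `l[X]` for nodes `l` of
`T` of any length, and if `l[X]` meets the set for each node `l`. -/
theorem DigitalTree.value_eq (hd : IsDigitSpace d) (T : DigitalTree k) {K : Set X}
    (hK : IsClosed K)
    (h₁ : ∀ x ∈ K, ∀ n, ∃ l, l.length = n ∧ T.mem l = true ∧ x ∈ Set.range (wordMap d l))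
    (h₂ : ∀ l, T.mem l = true → ∃ x ∈ K, x ∈ Set.range (wordMap d l)) : T.value d = K := by
  refine Set.Subset.antisymm (fun x hx => ?_) fun x hx => T.mem_value.2 (h₁ x hx)
  rw [← hK.closure_eq, Metric.mem_closure_iff]
  intro ε hε
  obtain ⟨s, b, hs⟩ := hd.exists_length
  obtain ⟨n, hn⟩ := exists_pow_lt_of_lt_one hε (one_half_lt_one (α := ℝ))
  obtain ⟨l, hl, hT, y, rfl⟩ := T.mem_value.1 hx (s * (n + b))
  obtain ⟨_, hz, z, rfl⟩ := h₂ l hT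
  exact ⟨_, hz, (hs n l hl.ge y z).trans_lt hn⟩

end Geometry

section HausdorffOfTree

variable {X : Type*} [MetricSpace X] {k : ℕ} {d : Fin k → X → X} {u : ℕ → X}

/-- All words of length `n` over the digits. -/
def allWords (k : ℕ) : ℕ → List (List (Fin k))
  | 0 => [[]]
  | n + 1 => (allWords k n).flatMap fun l => (List.finRange k).map fun a => a :: l

theorem mem_allWords {n : ℕ} {l : List (Fin k)} : l ∈ allWords k n ↔ l.length = n := by
  induction n generalizing l with
  | zero => simp [allWords]
  | succ n ih => cases l <;> simp [allWords, ih]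

theorem computable_allWords : Computable (allWords k) := by
  refine (Computable.nat_rec (f := id) (g := fun _ => [[]]) (h := fun _ p => p.2.flatMap fun l =>
    (List.finRange k).map fun a => a :: l) Computable.id (Computable.const _) ?_).of_eq fun n => ?_
  · refine Computable.list_flatMap (Computable.snd.comp Computable.snd) ?_
    refine Computable.list_map (Computable.const _) ?_
    exact Computable.list_cons.comp Computable.snd (Computable.snd.comp Computable.fst)
  · induction n with
    | zero => rfl
    | succ n ih => simp only [id] at ih ⊢; rw [ih]; rfl

/-- The nodes of a given list of words, where `bs` lists the values of the characteristic
function. -/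
def approxNodes (g : Fin k → ℕ → ℕ → ℕ) (p : ℕ) (ls : List (List (Fin k))) (bs : List Bool) :
    List ℕ :=
  (ls.zip bs).flatMap fun e => bif e.2 then [e.1.foldr (fun a i => g a i p) 0] else []

theorem computable_approxNodes {g : Fin k → ℕ → ℕ → ℕ} (hg : ∀ a, Computable₂ (g a)) :
    Computable fun e : ℕ × List (List (Fin k)) × List Bool => approxNodes g e.1 e.2.1 e.2.2 := by
  have hg' : Computable₂ fun (a : Fin k) (q : ℕ × ℕ) => g a q.1 q.2 :=
    Computable.fin_family (f := fun (a : Fin k) (q : ℕ × ℕ) => g a q.1 q.2) hg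
  have hw : Computable₂ fun (p : ℕ) (l : List (Fin k)) => l.foldr (fun a i => g a i p) 0 := by
    have hs : Computable₂ fun (e : ℕ × List (Fin k)) (b : Fin k × ℕ) => g b.1 b.2 e.1 :=
      hg'.comp (Computable.fst.comp Computable.snd)
        (Computable.pair (Computable.snd.comp Computable.snd)
          (Computable.fst.comp Computable.fst))
    exact Computable.list_foldr Computable.snd (Computable.const 0) hs
  have hc : Computable₂ fun (e : ℕ × List (List (Fin k)) × List Bool) (c : List (Fin k) × Bool) =>
      bif c.2 then [c.1.foldr (fun a i => g a i e.1) 0] else [] := by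
    have h1 : Computable₂ fun (e : ℕ × List (List (Fin k)) × List Bool)
        (c : List (Fin k) × Bool) => c.1.foldr (fun a i => g a i e.1) 0 :=
      hw.comp (Computable.fst.comp Computable.fst) (Computable.fst.comp Computable.snd)
    exact Computable.cond (Computable.snd.comp Computable.snd)
      (Computable.list_cons.comp h1 (Computable.const [])) (Computable.const [])
  exact Computable.list_flatMap (Computable.list_zip (Computable.fst.comp Computable.snd)
    (Computable.snd.comp Computable.snd)) hc

theorem mem_approxNodes {g : Fin k → ℕ → ℕ → ℕ} {p : ℕ} {ls : List (List (Fin k))}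
    {f : List (Fin k) → Bool} {i : ℕ} :
    i ∈ approxNodes g p ls (ls.map f) ↔
      ∃ l ∈ ls, f l = true ∧ i = l.foldr (fun a i => g a i p) 0 := by
  have : ls.zip (ls.map f) = ls.map fun l => (l, f l) := by
    induction ls with
    | nil => rfl
    | cons l ls ih => simp [ih]
  rw [approxNodes, this, List.flatMap_map, List.mem_flatMap]
  refine exists_congr fun l => and_congr_right fun _ => ?_
  cases f l <;> simp

theorem dist_wordMap_foldr_le (hd : IsDigitSpace d) {g : Fin k → ℕ → ℕ → ℕ}
    (hg : ∀ a i n, dist (d a (u i)) (u (g a i n)) < (1 / 2 : ℝ) ^ n) (p : ℕ)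
    (l : List (Fin k)) :
    dist (wordMap d l (u 0)) (u (l.foldr (fun a i => g a i p) 0)) ≤
      l.length * (1 / 2 : ℝ) ^ p := by
  induction l with
  | nil => simp [wordMap]
  | cons a l ih =>
    have h1 := hd.dist_le a (wordMap d l (u 0)) (u (l.foldr (fun a i => g a i p) 0))
    have h2 := hg a (l.foldr (fun a i => g a i p) 0) p
    have h3 := dist_triangle (d a (wordMap d l (u 0)))
      (d a (u (l.foldr (fun a i => g a i p) 0))) (u (g a (l.foldr (fun a i => g a i p) 0) p))
    simp only [wordMap, List.foldr_cons, List.length_cons, Nat.cast_add, Nat.cast_one] at *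
    linarith

/-- There is a computable operator that maps a digital tree to a name of its value. -/
theorem exists_hausdorff_operator (hX : IsComputableDigitSpace d u) :
    ∃ H : DigitalTree k → ℕ → List ℕ,
      IsComputableOperator DigitalTree.mem id (H : DigitalTree k →. (ℕ → List ℕ)) ∧
      ∀ T, HausdorffRep u (H T) (T.value d) := by
  have hd := hX.digitSpace
  have := hd.compactSpace
  choose g hgc hg using fun a => (hX.computableDigit a).approx
  obtain ⟨s, b, hs⟩ := hd.exists_length
  let N : ℕ → ℕ := fun n => s * (n + 2 + b)
  have hN : Computable N := by
    refine Computable.nat_mul.comp (Computable.const s) ?_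
    exact Computable.nat_add.comp (Computable.nat_add.comp Computable.id (Computable.const 2))
      (Computable.const b)
  let Q : ℕ → List (List (Fin k)) := fun n => allWords k (N n)
  have hQ : Computable Q := computable_allWords.comp hN
  let G : ℕ → List Bool → List ℕ := fun n bs => approxNodes g (N n + (n + 2)) (Q n) bs
  have hG : Computable₂ G := by
    refine (computable_approxNodes hgc).comp (Computable.pair ?_
      (Computable.pair (hQ.comp Computable.fst) Computable.snd))
    exact Computable.nat_add.comp (hN.comp Computable.fst)
      (Computable.nat_add.comp Computable.fst (Computable.const 2))
  refine ⟨fun T n => G n ((Q n).map T.mem), ?_, fun T => ?_⟩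
  · refine isComputableOperator_of_queries hQ hG fun T y hy c => ?_
    obtain rfl : y = _ := by simpa using hy
    rfl
  · have hne : (T.value d).Nonempty := by
      obtain ⟨x, hx, -⟩ := T.exists_mem_value hd T.nil_mem
      exact ⟨x, hx⟩
    refine ⟨hne, (T.isClosed_value hd).isCompact, fun n => ?_⟩
    have hmem : ∀ i, i ∈ G n ((Q n).map T.mem) ↔ ∃ l, l.length = N n ∧ T.mem l = true ∧
        i = l.foldr (fun a i => g a i (N n + (n + 2))) 0 := fun i => by
      simp only [G, mem_approxNodes, Q, mem_allWords]
    have hclose : ∀ l : List (Fin k), l.length = N n → ∀ x,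
        dist (wordMap d l x) (u (l.foldr (fun a i => g a i (N n + (n + 2))) 0)) ≤
          (1 / 2 : ℝ) ^ (n + 1) := by
      intro l hl x
      have h1 := hs (n + 2) l hl.ge x (u 0)
      have h2 := dist_wordMap_foldr_le hd hg (N n + (n + 2)) l
      have h3 : (l.length : ℝ) * (1 / 2 : ℝ) ^ (N n + (n + 2)) ≤ (1 / 2 : ℝ) ^ (n + 2) := by
        rw [hl, pow_add, ← mul_assoc]
        refine mul_le_of_le_one_left (by positivity) ?_
        have : (N n : ℝ) ≤ 2 ^ N n := by exact_mod_cast Nat.lt_two_pow_self.le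
        calc (N n : ℝ) * (1 / 2) ^ N n ≤ 2 ^ N n * (1 / 2) ^ N n := by gcongr
          _ = 1 := by rw [← mul_pow]; norm_num
      have h4 := dist_triangle (wordMap d l x) (wordMap d l (u 0))
        (u (l.foldr (fun a i => g a i (N n + (n + 2))) 0))
      have h5 : (1 / 2 : ℝ) ^ (n + 1) = (1 / 2) ^ (n + 2) + (1 / 2) ^ (n + 2) := by ring
      linarith
    constructor
    · obtain ⟨x, hx⟩ := hne
      obtain ⟨l, hl, hT, -⟩ := T.mem_value.1 hx (N n)
      exact List.ne_nil_of_mem ((hmem _).2 ⟨l, hl, hT, rfl⟩)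
    · refine (Metric.hausdorffDist_le_of_mem_dist (r := (1 / 2 : ℝ) ^ (n + 1)) (by positivity)
        ?_ ?_).trans_lt ?_
      · rintro _ ⟨i, hi, rfl⟩
        obtain ⟨l, hl, hT, rfl⟩ := (hmem i).1 hi
        obtain ⟨_, hx, x, rfl⟩ := T.exists_mem_value hd hT
        exact ⟨_, hx, by rw [dist_comm]; exact hclose l hl x⟩
      · intro x hx
        obtain ⟨l, hl, hT, y, rfl⟩ := T.mem_value.1 hx (N n)
        exact ⟨_, ⟨_, (hmem _).2 ⟨l, hl, hT, rfl⟩, rfl⟩, hclose l hl y⟩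
      · exact pow_lt_pow_right_of_lt_one₀ (by norm_num) (by norm_num) (Nat.lt_succ_self n)

end HausdorffOfTree

end DigitSpace

namespace DigitSpace

/-! ### Digits of points given by fast Cauchy sequences -/

section Digits

variable {k : ℕ} (A : ℕ → Fin k) (V : Fin k → ℕ → ℕ → ℕ) (r : ℕ → ℕ) (n₀ : ℕ)

/-- The sequence of indices that remains after splitting off `n` digits: the first digit of a
sequence is read off from its entry `n₀` by `A`, and it is split off by `V` and `r`. -/
def remainder (p : ℕ → ℕ) : ℕ → ℕ → ℕ
  | 0 => p
  | n + 1 => fun m => V (A (remainder p n n₀)) m (remainder p n (r m))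

/-- The first `n` digits of a sequence of indices. -/
def digits (n : ℕ) (p : ℕ → ℕ) : List (Fin k) :=
  (List.range n).map fun j => A (remainder A V r n₀ p j n₀)

/-- The counterpart of `remainder` for finite sequences. -/
def remainderList (c : List ℕ) : ℕ → List ℕ
  | 0 => c
  | n + 1 => (List.range (remainderList c n).length).map fun m =>
      V (A ((remainderList c n).getD n₀ 0)) m ((remainderList c n).getD (r m) 0)

/-- The counterpart of `digits` for finite sequences. -/
def digitsList (n : ℕ) (c : List ℕ) : List (Fin k) :=
  (List.range n).map fun j => A ((remainderList A V r n₀ c j).getD n₀ 0)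

variable {A V r n₀}

theorem digits_length (n : ℕ) (p : ℕ → ℕ) : (digits A V r n₀ n p).length = n := by
  simp [digits]

theorem digits_succ (n : ℕ) (p : ℕ → ℕ) :
    digits A V r n₀ (n + 1) p = digits A V r n₀ n p ++ [A (remainder A V r n₀ p n n₀)] := by
  simp [digits, List.range_succ]

theorem remainderList_length (c : List ℕ) (n : ℕ) :
    (remainderList A V r n₀ c n).length = c.length := by
  induction n with
  | zero => rfl
  | succ n ih => simpa [remainderList] using ih

theorem digits_eq_digitsList (hmono : Monotone r) (hr : ∀ m, m ≤ r m) {n : ℕ} {p : ℕ → ℕ}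
    {c : List ℕ} (hc : r^[n] n₀ < c.length) (h : ∀ m ≤ r^[n] n₀, p m = c.getD m 0) :
    digits A V r n₀ n p = digitsList A V r n₀ n c := by
  have hle : Monotone fun i => r^[i] n₀ := monotone_nat_of_le_succ fun i => by
    simpa only [Function.iterate_succ_apply'] using hr _
  have key : ∀ j ≤ n, ∀ m ≤ r^[n - j] n₀,
      remainder A V r n₀ p j m = (remainderList A V r n₀ c j).getD m 0 := by
    intro j
    induction j with
    | zero => simpa [remainder, remainderList] using h
    | succ j ih =>
      intro hj m hm
      have hm' : m < (remainderList A V r n₀ c j).length := by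
        rw [remainderList_length]
        exact (hm.trans (hle (Nat.sub_le _ _))).trans_lt hc
      have e : n - j = n - (j + 1) + 1 := by omega
      have h0 := ih (by omega) n₀ (hle (Nat.zero_le (n - j)))
      have h1 := ih (by omega) (r m) (by
        rw [e, Function.iterate_succ_apply']; exact hmono hm)
      simp only [remainder, remainderList, h0, h1]
      simp [hm']
  refine List.map_congr_left fun j hj => ?_
  rw [key j (List.mem_range.1 hj).le n₀ (hle (Nat.zero_le _))]

theorem computable_digitsList (hA : Computable A)
    (hV : Computable fun q : Fin k × ℕ × ℕ => V q.1 q.2.1 q.2.2) (hr : Computable r) :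
    Computable₂ (digitsList A V r n₀) := by
  have hstep : Computable fun c : List ℕ => (List.range c.length).map fun m =>
      V (A (c.getD n₀ 0)) m (c.getD (r m) 0) := by
    have h1 : Computable₂ fun (c : List ℕ) (m : ℕ) => V (A (c.getD n₀ 0)) m (c.getD (r m) 0) :=
      hV.comp (Computable.pair (hA.comp ((Computable.list_getD 0).comp Computable.fst
        (Computable.const n₀))) (Computable.pair Computable.snd
        ((Computable.list_getD 0).comp Computable.fst (hr.comp Computable.snd))))
    exact Computable.list_map (Computable.list_range.comp Computable.list_length) h1
  have hrem : Computable₂ (remainderList A V r n₀) := by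
    refine (Computable.nat_rec (f := fun q : List ℕ × ℕ => q.2) (g := fun q => q.1)
      (h := fun _ s => (List.range s.2.length).map fun m =>
        V (A (s.2.getD n₀ 0)) m (s.2.getD (r m) 0)) Computable.snd Computable.fst
      (hstep.comp (Computable.snd.comp Computable.snd))).of_eq fun q => ?_
    obtain ⟨c, n⟩ := q
    induction n with
    | zero => rfl
    | succ n ih => simp only at ih ⊢; rw [ih]; rfl
  have h2 : Computable₂ fun (q : ℕ × List ℕ) (j : ℕ) =>
      A ((remainderList A V r n₀ q.2 j).getD n₀ 0) :=
    hA.comp ((Computable.list_getD 0).comp (hrem.comp (Computable.snd.comp Computable.fst)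
      Computable.snd) (Computable.const n₀))
  exact Computable.list_map (Computable.list_range.comp Computable.fst) h2

end Digits

section Chains

variable {X : Type*} [MetricSpace X] {k : ℕ} {d : Fin k → X → X} {u : ℕ → X}

/-- The indices in `p` denote a fast Cauchy sequence. -/
def IsChain (u : ℕ → X) (p : ℕ → ℕ) : Prop :=
  ∀ m, dist (u (p m)) (u (p (m + 1))) < 2 * (1 / 2 : ℝ) ^ m

theorem IsChain.dist_lt {p : ℕ → ℕ} (h : IsChain u p) {m m' : ℕ} (hm : m ≤ m') :
    dist (u (p m)) (u (p m')) < 4 * (1 / 2 : ℝ) ^ m := by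
  have key : dist (u (p m)) (u (p m')) ≤ 4 * (1 / 2 : ℝ) ^ m - 4 * (1 / 2 : ℝ) ^ m' := by
    induction m', hm using Nat.le_induction with
    | base => simp
    | succ m' _ ih =>
      have h1 := dist_triangle (u (p m)) (u (p m')) (u (p (m' + 1)))
      have h2 := h m'
      rw [pow_succ]
      linarith
  have : (0 : ℝ) < (1 / 2) ^ m' := by positivity
  linarith

theorem IsChain.exists_tendsto [CompleteSpace X] {p : ℕ → ℕ} (h : IsChain u p) :
    ∃ x, Filter.Tendsto (fun m => u (p m)) Filter.atTop (nhds x) :=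
  cauchySeq_tendsto_of_complete
    (cauchySeq_of_le_geometric (1 / 2 : ℝ) 2 (by norm_num) fun m => (h m).le)

/-- The procedure given by `A`, `V`, `r` and `n₀` splits a fast Cauchy sequence into the first
digit of its limit and a fast Cauchy sequence. -/
structure IsDigitProcedure (d : Fin k → X → X) (u : ℕ → X) (A : ℕ → Fin k)
    (V : Fin k → ℕ → ℕ → ℕ) (r : ℕ → ℕ) (n₀ : ℕ) : Prop where
  computable_digit : Computable A
  computable_rest : Computable fun q : Fin k × ℕ × ℕ => V q.1 q.2.1 q.2.2
  computable_index : Computable r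
  monotone_index : Monotone r
  le_index : ∀ m, m ≤ r m
  isChain : ∀ p, IsChain u p → IsChain u fun m => V (A (p n₀)) m (p (r m))
  dist_le : ∀ p, IsChain u p → ∀ m,
    dist (d (A (p n₀)) (u (V (A (p n₀)) m (p (r m))))) (u (p (r m))) ≤ (1 / 2 : ℝ) ^ m

theorem IsDigitProcedure.isChain_remainder {A : ℕ → Fin k} {V : Fin k → ℕ → ℕ → ℕ}
    {r : ℕ → ℕ} {n₀ : ℕ} (h : IsDigitProcedure d u A V r n₀) {p : ℕ → ℕ} (hp : IsChain u p)
    (n : ℕ) : IsChain u (remainder A V r n₀ p n) := by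
  induction n with
  | zero => exact hp
  | succ n ih => exact h.isChain _ ih

/-- The limit of a fast Cauchy sequence `p` lies in `l[X]` for each prefix `l` of its digit
sequence. -/
theorem IsDigitProcedure.mem_range_wordMap (hd : IsDigitSpace d) {A : ℕ → Fin k}
    {V : Fin k → ℕ → ℕ → ℕ} {r : ℕ → ℕ} {n₀ : ℕ} (h : IsDigitProcedure d u A V r n₀)
    {p : ℕ → ℕ} (hp : IsChain u p) {x : X}
    (hx : Filter.Tendsto (fun m => u (p m)) Filter.atTop (nhds x)) (n : ℕ) :
    x ∈ Set.range (wordMap d (digits A V r n₀ n p)) := by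
  have := hd.complete
  choose y hy using fun n => (h.isChain_remainder hp n).exists_tendsto
  have hstep : ∀ n, d (A (remainder A V r n₀ p n n₀)) (y (n + 1)) = y n := by
    intro n
    set a := A (remainder A V r n₀ p n n₀) with ha
    have h1 : Filter.Tendsto (fun m => d a (u (remainder A V r n₀ p (n + 1) m)))
        Filter.atTop (nhds (d a (y (n + 1)))) :=
      ((hd.continuous a).tendsto _).comp (hy (n + 1))
    have h2 : Filter.Tendsto (fun m => u (remainder A V r n₀ p n (r m)))
        Filter.atTop (nhds (y n)) :=
      (hy n).comp (Filter.tendsto_atTop_mono h.le_index Filter.tendsto_id)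
    have h3 : Filter.Tendsto (fun m => dist (d a (u (remainder A V r n₀ p (n + 1) m)))
        (u (remainder A V r n₀ p n (r m)))) Filter.atTop (nhds 0) :=
      squeeze_zero (fun _ => dist_nonneg) (h.dist_le _ (h.isChain_remainder hp n))
        (tendsto_pow_atTop_nhds_zero_of_lt_one (by norm_num) (by norm_num))
    exact dist_eq_zero.1 (tendsto_nhds_unique (h1.dist h2) h3)
  have key : ∀ n, wordMap d (digits A V r n₀ n p) (y n) = y 0 := by
    intro n
    induction n with
    | zero => rfl
    | succ n ih =>
      rw [digits_succ, wordMap_append, ← ih]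
      exact congrArg _ (hstep n)
  exact ⟨y n, (key n).trans (tendsto_nhds_unique (hy 0) hx)⟩

theorem posRatOf_pred_two_pow (c n : ℕ) :
    (posRatOf (c, 2 ^ n - 1) : ℝ) = (c + 1) * (1 / 2 : ℝ) ^ n := by
  have h : ((2 ^ n - 1 : ℕ) : ℝ) + 1 = 2 ^ n := by
    rw [Nat.cast_sub Nat.one_le_two_pow]; push_cast; ring
  simp only [posRatOf, Rat.cast_div, Rat.cast_add, Rat.cast_natCast, Rat.cast_one, h]
  rw [one_div, inv_pow, div_eq_mul_inv]

theorem one_half_pow_le_posRatOf (t : ℕ × ℕ) : (1 / 2 : ℝ) ^ t.2 ≤ (posRatOf t : ℝ) := by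
  have h : (t.2 : ℝ) + 1 ≤ 2 ^ t.2 := by exact_mod_cast Nat.lt_two_pow_self (n := t.2)
  simp only [posRatOf, Rat.cast_div, Rat.cast_add, Rat.cast_natCast, Rat.cast_one]
  rw [one_div, inv_pow, ← one_div]
  have : (0 : ℝ) ≤ t.1 := Nat.cast_nonneg _
  gcongr
  linarith

theorem exists_computable_bound {f : Fin k → ℕ → ℕ} (hf : ∀ a, Computable (f a)) :
    ∃ s : ℕ → ℕ, Computable s ∧ ∀ a m, f a m ≤ s m := by
  refine ⟨fun m => (List.finRange k).foldr (fun a s => f a m + s) 0, ?_, fun a m => ?_⟩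
  · have h : Computable₂ fun (m : ℕ) (q : Fin k × ℕ) => f q.1 m + q.2 :=
      Computable.nat_add.comp ((Computable.fin_family hf).comp
        (Computable.fst.comp Computable.snd) Computable.fst)
        (Computable.snd.comp Computable.snd)
    exact Computable.list_foldr (Computable.const _) (Computable.const 0) h
  · have : ∀ l : List (Fin k), a ∈ l → f a m ≤ l.foldr (fun a s => f a m + s) 0 := by
      intro l
      induction l with
      | nil => simp
      | cons b l ih =>
        intro h
        rw [List.foldr_cons]
        rcases List.mem_cons.1 h with rfl | h
        · exact Nat.le_add_right _ _
        · exact (ih h).trans (Nat.le_add_left _ _)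
    exact this _ (List.mem_finRange a)

/-- Any computable function is below a computable monotone one. -/
theorem exists_monotone_bound {s : ℕ → ℕ} (hs : Computable s) :
    ∃ r : ℕ → ℕ, Computable r ∧ Monotone r ∧ ∀ m, m ≤ r m ∧ s m ≤ r m := by
  refine ⟨fun m => Nat.rec (s 0) (fun j q => q + s (j + 1) + 1) m, ?_, ?_, fun m => ?_⟩
  · have h : Computable₂ fun (_ : ℕ) (q : ℕ × ℕ) => q.2 + s (q.1 + 1) + 1 :=
      Computable.succ.comp (Computable.nat_add.comp (Computable.snd.comp Computable.snd)
        (hs.comp (Computable.succ.comp (Computable.fst.comp Computable.snd))))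
    exact Computable.nat_rec Computable.id (Computable.const (s 0)) h
  · exact monotone_nat_of_le_succ fun m => by simp only; omega
  · induction m with
    | zero => simp
    | succ m ih =>
      obtain ⟨h1, -⟩ := ih
      simp only at h1 ⊢
      constructor <;> omega

theorem ComputablePred.comp {α β : Type*} [Primcodable α] [Primcodable β] {P : β → Prop}
    (hP : ComputablePred P) {f : α → β} (hf : Computable f) :
    ComputablePred fun a => P (f a) := by
  obtain ⟨c, hc, rfl⟩ := ComputablePred.computable_iff.1 hP
  exact ComputablePred.computable_iff.2 ⟨_, hc.comp hf, rfl⟩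

theorem exists_digitProcedure (hX : IsComputableDigitSpace d u) (hcov : IsWellCovering d)
    (hdec : IsDecidable d u) (hchoice : HasApproximableChoice d u) :
    ∃ A V r n₀, IsDigitProcedure d u A V r n₀ := by
  have hd := hX.digitSpace
  obtain ⟨δ, hδ, hball⟩ := hcov.exists_ball_subset hd
  obtain ⟨n₀, hn₀⟩ := exists_pow_lt_of_lt_one (show 0 < δ / 8 by positivity)
    (one_half_lt_one (α := ℝ))
  have hA₀ : ComputablePred fun q : ℕ × Fin k =>
      Metric.ball (u q.1) (posRatOf (7, 2 ^ n₀ - 1) : ℝ) ⊆ Set.range (d q.2) :=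
    ComputablePred.comp (f := fun q : ℕ × Fin k => (q.1, ((7, 2 ^ n₀ - 1) : ℕ × ℕ), q.2)) hdec
      (Computable.pair Computable.fst (Computable.pair (Computable.const _) Computable.snd))
  obtain ⟨A, hAc, hA⟩ := Computable.exists_fin_choice
    (P := fun i a => Metric.ball (u i) (posRatOf (7, 2 ^ n₀ - 1) : ℝ) ⊆ Set.range (d a))
    hA₀ fun i => by
    obtain ⟨a, ha⟩ := hball (u i)
    refine ⟨a, (Metric.ball_subset_ball ?_).trans ha⟩
    rw [posRatOf_pred_two_pow]
    norm_num at hn₀ ⊢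
    linarith
  choose v hφ hcauchy ht hz using hchoice
  choose φ hφp hφv using hφ
  choose t htc ht using ht
  let θ : ℕ → ℕ × ℕ := fun m => (0, 2 ^ m - 1)
  have hθ : ∀ m, (posRatOf (θ m) : ℝ) = (1 / 2 : ℝ) ^ m := fun m => by
    simp only [θ, posRatOf_pred_two_pow]; norm_num
  have hθc : Computable θ := Computable.pair (Computable.const 0)
    (Computable.nat_sub.comp (Computable.nat_pow.comp (Computable.const 2) Computable.id)
      (Computable.const 1))
  let W : Fin k → ℕ → Prop := fun a i =>
    Metric.ball (u i) (posRatOf (3, 2 ^ n₀ - 1) : ℝ) ⊆ Set.range (d a)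
  have hW : ∀ {a i}, W a i → u i ∈ Set.range (d a) := fun {a i} h => h (by
    rw [Metric.mem_ball, dist_self, posRatOf_pred_two_pow]; positivity)
  have hWc : ∀ a, ComputablePred fun q : ℕ × ℕ => W a q.2 := fun a =>
    ComputablePred.comp (f := fun q : ℕ × ℕ => (q.2, ((3, 2 ^ n₀ - 1) : ℕ × ℕ), a)) hdec
      (Computable.pair Computable.snd (Computable.pair (Computable.const _) (Computable.const a)))
  have hext : ∀ a, ∃ f : ℕ × ℕ → ℕ, Computable f ∧ ∀ q, W a q.2 → f q ∈ φ a (θ q.1, q.2) :=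
    fun a => Computable.exists_extension (hWc a)
      ((hφp a).comp (Computable.pair (hθc.comp Computable.fst) Computable.snd))
      fun q hq => Part.dom_iff_mem.2 ⟨_, hφv a (θ q.1) q.2 (hW hq)⟩
  choose f hfc hf using hext
  have hfv : ∀ {a m i}, W a i → f a (m, i) = v a (θ m) i := fun {a m i} h =>
    Part.mem_unique (hf a (m, i) h) (hφv a (θ m) i (hW h))
  obtain ⟨s, hsc, hs⟩ := exists_computable_bound (f := fun a m => (t a (θ m)).2)
    fun a => Computable.snd.comp ((htc a).comp hθc)
  obtain ⟨r, hrc, hrm, hr⟩ := exists_monotone_bound (s := fun m => n₀ + (s m + 2))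
    (Computable.nat_add.comp (Computable.const n₀)
      (Computable.nat_add.comp hsc (Computable.const 2)))
  have hWp : ∀ {p}, IsChain u p → ∀ m, W (A (p n₀)) (p (r m)) := by
    intro p hp m
    refine (Metric.ball_subset_ball' ?_).trans (hA (p n₀))
    have h1 := hp.dist_lt (m := n₀) (m' := r m) (by have := (hr m).2; omega)
    rw [dist_comm, posRatOf_pred_two_pow, posRatOf_pred_two_pow]
    norm_num at h1 ⊢
    linarith
  refine ⟨A, fun a m i => f a (m, i), r, n₀, hAc, Computable.fin_family hfc, hrc, hrm,
    fun m => (hr m).1, fun p hp m => ?_, fun p hp m => ?_⟩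
  · have hi := hWp hp m
    have hj := hWp hp (m + 1)
    have h1 : dist (u (p (r m))) (u (p (r (m + 1)))) < (posRatOf (t (A (p n₀)) (θ m)) : ℝ) := by
      refine (hp.dist_lt (hrm m.le_succ)).trans_le (le_trans ?_ (one_half_pow_le_posRatOf _))
      have h2 : (t (A (p n₀)) (θ m)).2 + 2 ≤ r m := by
        have h3 : (t (A (p n₀)) (θ m)).2 ≤ s m := hs (A (p n₀)) m
        have h4 : n₀ + (s m + 2) ≤ r m := (hr m).2
        omega
      calc 4 * (1 / 2 : ℝ) ^ r m ≤ 4 * (1 / 2 : ℝ) ^ ((t (A (p n₀)) (θ m)).2 + 2) := by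
            refine mul_le_mul_of_nonneg_left ?_ (by norm_num)
            exact pow_le_pow_of_le_one (by norm_num) (by norm_num) h2
        _ = _ := by rw [pow_add]; ring
    have h5 := ht (A (p n₀)) (θ m) _ _ (hW hi) (hW hj) h1
    have h6 := hcauchy (A (p n₀)) (θ m) (θ (m + 1)) _ (hW hj)
    have h7 : (1 / 2 : ℝ) ^ (m + 1) ≤ (1 / 2 : ℝ) ^ m :=
      pow_le_pow_of_le_one (by norm_num) (by norm_num) m.le_succ
    rw [hθ, hθ, max_eq_left h7] at h6
    rw [hθ] at h5
    simp only [hfv hi, hfv hj]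
    linarith [dist_triangle (u (v (A (p n₀)) (θ m) (p (r m))))
      (u (v (A (p n₀)) (θ m) (p (r (m + 1))))) (u (v (A (p n₀)) (θ (m + 1)) (p (r (m + 1)))))]
  · have hi := hWp hp m
    obtain ⟨z, hzi, hzd⟩ := hz (A (p n₀)) (θ m) _ (hW hi)
    rw [hθ] at hzd
    simp only [hfv hi]
    rw [← hzi, dist_comm]
    exact (hd.dist_le _ _ _).trans hzd.le

end Chains

end DigitSpace

namespace DigitSpace

section TreeOfCompactSet

variable {X : Type*} [MetricSpace X] {k : ℕ} {d : Fin k → X → X} {u : ℕ → X}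

/-- `p` chooses from each list of `w` an index, where subsequent choices are related by `e`. -/
def IsPath (e : ℕ → ℕ → ℕ → Bool) (w : ℕ → List ℕ) (p : ℕ → ℕ) : Prop :=
  ∀ m, p m ∈ w m ∧ e m (p m) (p (m + 1)) = true

/-- The decidable relation `e m i j` approximates the relation
`dist (u i) (u j) < 2 * 2⁻ᵐ`. -/
structure IsLink (u : ℕ → X) (e : ℕ → ℕ → ℕ → Bool) : Prop where
  computable : Computable fun q : ℕ × ℕ × ℕ => e q.1 q.2.1 q.2.2
  lt_of_true : ∀ m i j, e m i j = true → dist (u i) (u j) < 2 * (1 / 2 : ℝ) ^ m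
  true_of_lt : ∀ m i j, dist (u i) (u j) < 3 / 2 * (1 / 2 : ℝ) ^ m → e m i j = true

theorem ratOf_pred_two_pow (c n : ℕ) :
    (ratOf (c, 0, 2 ^ n - 1) : ℝ) = c * (1 / 2 : ℝ) ^ n := by
  have h : ((2 ^ n - 1 : ℕ) : ℝ) + 1 = 2 ^ n := by
    rw [Nat.cast_sub Nat.one_le_two_pow]; push_cast; ring
  simp only [ratOf, Rat.cast_div, Rat.cast_add, Rat.cast_sub, Rat.cast_natCast, Rat.cast_one, h]
  rw [one_div, inv_pow, div_eq_mul_inv, Nat.cast_zero, sub_zero]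

theorem REPred.comp {α β : Type*} [Primcodable α] [Primcodable β] {P : β → Prop}
    (hP : REPred P) {f : α → β} (hf : Computable f) : REPred fun a => P (f a) :=
  Partrec.comp hP hf

theorem IsComputableMetric.exists_isLink (h : IsComputableMetric u) : ∃ e, IsLink u e := by
  have hpow : ∀ c : ℕ, Computable fun m : ℕ => ((c, 0, 2 ^ m - 1) : ℕ × ℕ × ℕ) := fun c =>
    Computable.pair (Computable.const c) (Computable.pair (Computable.const 0)
      (Computable.nat_sub.comp (Computable.nat_pow.comp (Computable.const 2) Computable.id)
        (Computable.const 1)))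
  have h1 : Computable fun q : ℕ × ℕ × ℕ =>
      ((q.2.1, q.2.2, (2, 0, 2 ^ q.1 - 1)) : ℕ × ℕ × (ℕ × ℕ × ℕ)) :=
    Computable.pair (Computable.fst.comp Computable.snd) (Computable.pair
      (Computable.snd.comp Computable.snd) ((hpow 2).comp Computable.fst))
  have h2 : Computable fun q : ℕ × ℕ × ℕ =>
      ((q.2.1, q.2.2, (3, 0, 2 ^ (q.1 + 1) - 1)) : ℕ × ℕ × (ℕ × ℕ × ℕ)) :=
    Computable.pair (Computable.fst.comp Computable.snd) (Computable.pair
      (Computable.snd.comp Computable.snd)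
      ((hpow 3).comp (Computable.succ.comp Computable.fst)))
  have hP : REPred fun q : ℕ × ℕ × ℕ =>
      dist (u q.2.1) (u q.2.2) < (ratOf (2, 0, 2 ^ q.1 - 1) : ℝ) :=
    REPred.comp (f := fun q : ℕ × ℕ × ℕ =>
      ((q.2.1, q.2.2, (2, 0, 2 ^ q.1 - 1)) : ℕ × ℕ × (ℕ × ℕ × ℕ))) h.lt_re h1
  have hQ : REPred fun q : ℕ × ℕ × ℕ =>
      (ratOf (3, 0, 2 ^ (q.1 + 1) - 1) : ℝ) < dist (u q.2.1) (u q.2.2) :=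
    REPred.comp (f := fun q : ℕ × ℕ × ℕ =>
      ((q.2.1, q.2.2, (3, 0, 2 ^ (q.1 + 1) - 1)) : ℕ × ℕ × (ℕ × ℕ × ℕ))) h.gt_re h2
  obtain ⟨c, hc, H⟩ := Computable.exists_separator hP hQ fun q => by
    rw [ratOf_pred_two_pow, ratOf_pred_two_pow, pow_succ]
    have : (0 : ℝ) < (1 / 2) ^ q.1 := by positivity
    by_contra! hcon
    push_cast at hcon
    linarith [hcon.1, hcon.2]
  refine ⟨fun m i j => c (m, i, j), hc, fun m i j hm => ?_, fun m i j hm => ?_⟩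
  · simpa only [ratOf_pred_two_pow, Nat.cast_ofNat] using (H (m, i, j)).1 hm
  · by_contra hf
    have := (H (m, i, j)).2 (by simpa using hf)
    rw [ratOf_pred_two_pow, pow_succ] at this
    push_cast at this
    linarith

theorem IsPath.isChain {e : ℕ → ℕ → ℕ → Bool} (he : IsLink u e) {w : ℕ → List ℕ} {p : ℕ → ℕ}
    (hp : IsPath e w p) : IsChain u p :=
  fun m => he.lt_of_true m _ _ (hp m).2

theorem hausdorffEDist_basicSet_ne_top {l : List ℕ} (hl : l ≠ []) {K : Set X}
    (hne : K.Nonempty) (hK : IsCompact K) : Metric.hausdorffEDist (basicSet u l) K ≠ ⊤ := by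
  refine Metric.hausdorffEDist_ne_top_of_nonempty_of_bounded ?_ hne ?_ hK.isBounded
  · obtain ⟨i, hi⟩ := List.exists_mem_of_ne_nil l hl
    exact ⟨u i, i, hi, rfl⟩
  · exact ((List.finite_toSet l).image u).isBounded

theorem HausdorffRep.exists_mem_set {w : ℕ → List ℕ} {K : Set X} (h : HausdorffRep u w K)
    {m i : ℕ} (hi : i ∈ w m) : ∃ x ∈ K, dist (u i) x < (1 / 2 : ℝ) ^ m := by
  obtain ⟨hne, hK, hw⟩ := h
  exact Metric.exists_dist_lt_of_hausdorffDist_lt (s := basicSet u (w m)) (x := u i)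
    ⟨i, hi, rfl⟩ (hw m).2
    (hausdorffEDist_basicSet_ne_top (hw m).1 hne hK)

theorem HausdorffRep.exists_mem_list {w : ℕ → List ℕ} {K : Set X} (h : HausdorffRep u w K)
    {x : X} (hx : x ∈ K) (m : ℕ) : ∃ i ∈ w m, dist (u i) x < (1 / 2 : ℝ) ^ m := by
  obtain ⟨hne, hK, hw⟩ := h
  obtain ⟨_, ⟨i, hi, rfl⟩, hd⟩ := Metric.exists_dist_lt_of_hausdorffDist_lt' hx (hw m).2
    (hausdorffEDist_basicSet_ne_top (hw m).1 hne hK)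
  exact ⟨i, hi, hd⟩

theorem HausdorffRep.mem_of_tendsto {w : ℕ → List ℕ} {K : Set X} (h : HausdorffRep u w K)
    {p : ℕ → ℕ} (hp : ∀ m, p m ∈ w m) {x : X}
    (hx : Filter.Tendsto (fun m => u (p m)) Filter.atTop (nhds x)) : x ∈ K := by
  choose y hy hd using fun m => h.exists_mem_set (hp m)
  have h0 : Filter.Tendsto (fun m => dist (u (p m)) (y m)) Filter.atTop (nhds 0) :=
    squeeze_zero (fun _ => dist_nonneg) (fun m => (hd m).le)
      (tendsto_pow_atTop_nhds_zero_of_lt_one (by norm_num) (by norm_num))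
  exact h.2.1.isClosed.mem_of_tendsto ((tendsto_iff_of_dist h0).1 hx)
    (Filter.Eventually.of_forall hy)

theorem IsLink.of_dist_lt {e : ℕ → ℕ → ℕ → Bool} (he : IsLink u e) {m i j : ℕ} {x : X}
    (hi : dist (u i) x < (1 / 2 : ℝ) ^ m) (hj : dist (u j) x < (1 / 2 : ℝ) ^ (m + 1)) :
    e m i j = true := by
  refine he.true_of_lt m i j ?_
  have := dist_triangle_right (u i) (u j) x
  rw [pow_succ] at hj
  linarith

theorem HausdorffRep.exists_isPath {e : ℕ → ℕ → ℕ → Bool} (he : IsLink u e) {w : ℕ → List ℕ}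
    {K : Set X} (h : HausdorffRep u w K) {x : X} (hx : x ∈ K) :
    ∃ p, IsPath e w p ∧ Filter.Tendsto (fun m => u (p m)) Filter.atTop (nhds x) := by
  choose p hp hd using h.exists_mem_list hx
  refine ⟨p, fun m => ⟨hp m, he.of_dist_lt (hd m) (hd (m + 1))⟩, ?_⟩
  exact tendsto_iff_dist_tendsto_zero.2 (squeeze_zero (fun _ => dist_nonneg)
    (fun m => (hd m).le)
    (tendsto_pow_atTop_nhds_zero_of_lt_one (by norm_num) (by norm_num)))

/-- Finite paths through a name of a compact set can be extended. -/
theorem HausdorffRep.exists_isPath_extension {e : ℕ → ℕ → ℕ → Bool} (he : IsLink u e)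
    {w : ℕ → List ℕ} {K : Set X} (h : HausdorffRep u w K) {n : ℕ} {q : ℕ → ℕ}
    (hq : ∀ m ≤ n, q m ∈ w m) (hqe : ∀ m < n, e m (q m) (q (m + 1)) = true) :
    ∃ p, IsPath e w p ∧ ∀ m ≤ n, p m = q m := by
  obtain ⟨x, hx, hxd⟩ := h.exists_mem_set (hq n le_rfl)
  choose f hf hfd using h.exists_mem_list hx
  refine ⟨fun m => if m ≤ n then q m else f m, fun m => ⟨?_, ?_⟩, fun m hm => if_pos hm⟩
  · by_cases hm : m ≤ n
    · simpa [hm] using hq m hm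
    · simpa [hm] using hf m
  · rcases lt_trichotomy m n with hm | rfl | hm
    · simpa [hm.le, Nat.succ_le_of_lt hm] using hqe m hm
    · simpa using he.of_dist_lt hxd (hfd (m + 1))
    · have h1 : ¬ m ≤ n := by omega
      have h2 : ¬ m + 1 ≤ n := by omega
      simpa [h1, h2] using he.of_dist_lt (hfd m) (hfd (m + 1))

open Classical in
/-- The tree of all prefixes of the digit sequences of the paths through a name of a compact
set. -/
noncomputable def pathTree {A : ℕ → Fin k} {V : Fin k → ℕ → ℕ → ℕ} {r : ℕ → ℕ} {n₀ : ℕ}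
    {e : ℕ → ℕ → ℕ → Bool} {w : ℕ → List ℕ} (hw : ∃ p, IsPath e w p) : DigitalTree k where
  mem l := decide (∃ p, IsPath e w p ∧ digits A V r n₀ l.length p = l)
  nil_mem := by
    obtain ⟨p, hp⟩ := hw
    exact decide_eq_true ⟨p, hp, rfl⟩
  prefix_mem l a h := by
    obtain ⟨p, hp, hl⟩ := of_decide_eq_true h
    rw [List.length_append, List.length_singleton, digits_succ] at hl
    exact decide_eq_true ⟨p, hp, (List.append_inj hl (digits_length _ _)).1⟩
  exists_succ l h := by
    obtain ⟨p, hp, hl⟩ := of_decide_eq_true h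
    refine ⟨A (remainder A V r n₀ p l.length n₀), decide_eq_true ⟨p, hp, ?_⟩⟩
    rw [List.length_append, List.length_singleton, digits_succ, hl]

theorem pathTree_mem {A : ℕ → Fin k} {V : Fin k → ℕ → ℕ → ℕ} {r : ℕ → ℕ} {n₀ : ℕ}
    {e : ℕ → ℕ → ℕ → Bool} {w : ℕ → List ℕ} (hw : ∃ p, IsPath e w p) (l : List (Fin k)) :
    (pathTree (A := A) (V := V) (r := r) (n₀ := n₀) hw).mem l = true ↔
      ∃ p, IsPath e w p ∧ digits A V r n₀ l.length p = l := by
  simp [pathTree]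

theorem value_pathTree (hd : IsDigitSpace d) {A : ℕ → Fin k} {V : Fin k → ℕ → ℕ → ℕ}
    {r : ℕ → ℕ} {n₀ : ℕ} (hA : IsDigitProcedure d u A V r n₀) {e : ℕ → ℕ → ℕ → Bool}
    (he : IsLink u e) {w : ℕ → List ℕ} {K : Set X} (hK : HausdorffRep u w K)
    (hw : ∃ p, IsPath e w p) :
    (pathTree (A := A) (V := V) (r := r) (n₀ := n₀) hw).value d = K := by
  have := hd.complete
  refine DigitalTree.value_eq hd _ hK.2.1.isClosed (fun x hx n => ?_) fun l hl => ?_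
  · obtain ⟨p, hp, hpx⟩ := hK.exists_isPath he hx
    refine ⟨digits A V r n₀ n p, digits_length n p, (pathTree_mem hw _).2 ⟨p, hp, ?_⟩,
      hA.mem_range_wordMap hd (hp.isChain he) hpx n⟩
    rw [digits_length]
  · obtain ⟨p, hp, hl⟩ := (pathTree_mem hw _).1 hl
    obtain ⟨x, hx⟩ := (hp.isChain he).exists_tendsto
    refine ⟨x, hK.mem_of_tendsto (fun m => (hp m).1) hx, ?_⟩
    rw [← hl]
    exact hA.mem_range_wordMap hd (hp.isChain he) hx _

/-- Whether the word `l` is given by a finite path through the lists in `ws`. -/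
def checkWord (A : ℕ → Fin k) (V : Fin k → ℕ → ℕ → ℕ) (r : ℕ → ℕ) (n₀ : ℕ)
    (e : ℕ → ℕ → ℕ → Bool) (l : List (Fin k)) (ws : List (List ℕ)) : Bool :=
  ws.sections.any fun c =>
    ((List.range (c.length - 1)).all fun m => e m (c.getD m 0) (c.getD (m + 1) 0)) &&
      decide (digitsList A V r n₀ l.length c = l)

theorem computable_checkWord {A : ℕ → Fin k} {V : Fin k → ℕ → ℕ → ℕ} {r : ℕ → ℕ} {n₀ : ℕ}
    (hA : IsDigitProcedure d u A V r n₀) {e : ℕ → ℕ → ℕ → Bool} (he : IsLink u e) :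
    Computable₂ (checkWord A V r n₀ e) := by
  have h1 : Computable₂ fun (c : List ℕ) (m : ℕ) => e m (c.getD m 0) (c.getD (m + 1) 0) :=
    he.computable.comp (Computable.pair Computable.snd (Computable.pair
      ((Computable.list_getD 0).comp Computable.fst Computable.snd)
      ((Computable.list_getD 0).comp Computable.fst (Computable.succ.comp Computable.snd))))
  have h2 : Computable fun c : List ℕ =>
      (List.range (c.length - 1)).all fun m => e m (c.getD m 0) (c.getD (m + 1) 0) :=
    Computable.list_all (Computable.list_range.comp
      (Computable.nat_sub.comp Computable.list_length (Computable.const 1))) h1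
  have hdig : Computable fun q : (List (Fin k) × List (List ℕ)) × List ℕ =>
      digitsList A V r n₀ q.1.1.length q.2 :=
    (computable_digitsList hA.computable_digit hA.computable_rest hA.computable_index).comp
      (Computable.list_length.comp (Computable.fst.comp Computable.fst)) Computable.snd
  have heq : Computable₂ fun a b : List (Fin k) => decide (a = b) :=
    Primrec.eq.decide.to_comp
  have h4 : Computable fun q : (List (Fin k) × List (List ℕ)) × List ℕ =>
      (List.range (q.2.length - 1)).all fun m => e m (q.2.getD m 0) (q.2.getD (m + 1) 0) :=
    h2.comp Computable.snd
  have h5 : Computable fun q : (List (Fin k) × List (List ℕ)) × List ℕ =>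
      decide (digitsList A V r n₀ q.1.1.length q.2 = q.1.1) :=
    heq.comp hdig (Computable.fst.comp Computable.fst)
  have h6 : Computable₂ fun (q : List (Fin k) × List (List ℕ)) (c : List ℕ) =>
      ((List.range (c.length - 1)).all fun m => e m (c.getD m 0) (c.getD (m + 1) 0)) &&
        decide (digitsList A V r n₀ q.1.length c = q.1) :=
    Primrec.and.to_comp.comp h4 h5
  exact Computable.list_any (Computable.list_sections.comp Computable.snd) h6

theorem pathTree_mem_eq_checkWord {A : ℕ → Fin k} {V : Fin k → ℕ → ℕ → ℕ}
    {r : ℕ → ℕ} {n₀ : ℕ} (hA : IsDigitProcedure d u A V r n₀) {e : ℕ → ℕ → ℕ → Bool}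
    (he : IsLink u e) {w : ℕ → List ℕ} {K : Set X} (hK : HausdorffRep u w K)
    (hw : ∃ p, IsPath e w p) (l : List (Fin k)) :
    (pathTree (A := A) (V := V) (r := r) (n₀ := n₀) hw).mem l =
      checkWord A V r n₀ e l ((List.range (r^[l.length] n₀ + 1)).map w) := by
  rw [Bool.eq_iff_iff, pathTree_mem]
  simp only [checkWord, List.any_eq_true, List.mem_sections, Bool.and_eq_true,
    decide_eq_true_eq, List.all_eq_true, List.mem_range]
  set R := r^[l.length] n₀ with hR
  constructor
  · rintro ⟨p, hp, hl⟩
    have hget : ∀ m ≤ R, ((List.range (R + 1)).map p).getD m 0 = p m := fun m hm => by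
      have : m < R + 1 := by omega
      simp [this]
    refine ⟨(List.range (R + 1)).map p, ?_, fun m hm => ?_, ?_⟩
    · rw [List.forall₂_map_left_iff, List.forall₂_map_right_iff, List.forall₂_same]
      exact fun m _ => (hp m).1
    · rw [List.length_map, List.length_range] at hm
      rw [hget m (by omega), hget (m + 1) (by omega)]
      exact (hp m).2
    · rw [← digits_eq_digitsList hA.monotone_index hA.le_index (p := p) (by simp [hR])
        fun m hm => (hget m hm).symm]
      exact hl
  · rintro ⟨c, hc, hce, hl⟩
    have hlen : c.length = R + 1 := by simpa using hc.length_eq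
    have hcw : ∀ m ≤ R, c.getD m 0 ∈ w m := fun m hm => by
      have h1 : m < c.length := by omega
      have h2 := hc.get h1 (by simpa [hlen] using h1)
      simpa [h1] using h2
    obtain ⟨p, hp, hpc⟩ := hK.exists_isPath_extension he hcw fun m hm => hce m (by omega)
    refine ⟨p, hp, ?_⟩
    rw [digits_eq_digitsList hA.monotone_index hA.le_index (by omega) hpc]
    exact hl

/-- There is a computable operator that maps each name of a compact set to a digital tree with
this value. -/
theorem exists_tree_operator (hX : IsComputableDigitSpace d u) (hcov : IsWellCovering d)
    (hdec : IsDecidable d u) (hchoice : HasApproximableChoice d u) :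
    ∃ J : (ℕ → List ℕ) →. DigitalTree k, IsComputableOperator id DigitalTree.mem J ∧
      (∀ w, (J w).Dom ↔ ∃ K, HausdorffRep u w K) ∧
      ∀ w, ∀ T ∈ J w, ∀ K, HausdorffRep u w K → T.value d = K := by
  have hd := hX.digitSpace
  obtain ⟨A, V, r, n₀, hA⟩ := exists_digitProcedure hX hcov hdec hchoice
  obtain ⟨e, he⟩ := hX.computableMetric.exists_isLink
  have hpath : ∀ w, (∃ K, HausdorffRep u w K) → ∃ p, IsPath e w p := by
    rintro w ⟨K, hK⟩
    obtain ⟨x, hx⟩ := hK.1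
    obtain ⟨p, hp, -⟩ := hK.exists_isPath he hx
    exact ⟨p, hp⟩
  let J : (ℕ → List ℕ) →. DigitalTree k := fun w =>
    ⟨∃ K, HausdorffRep u w K, fun h => pathTree (A := A) (V := V) (r := r) (n₀ := n₀) (hpath w h)⟩
  refine ⟨J, ?_, fun w => Iff.rfl, ?_⟩
  · have hQ : Computable fun l : List (Fin k) => List.range (r^[l.length] n₀ + 1) := by
      refine Computable.list_range.comp (Computable.succ.comp ?_)
      refine (Computable.nat_rec (f := fun l : List (Fin k) => l.length) (g := fun _ => n₀)
        (h := fun _ q => r q.2) Computable.list_length (Computable.const n₀)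
        (hA.computable_index.comp (Computable.snd.comp Computable.snd))).of_eq fun l => ?_
      induction l.length with
      | zero => rfl
      | succ n ih => rw [Function.iterate_succ_apply', ← ih]
    refine isComputableOperator_of_queries hQ (computable_checkWord hA he) ?_
    rintro w _ ⟨⟨K, hK⟩, rfl⟩ l
    exact pathTree_mem_eq_checkWord hA he hK (hpath w ⟨K, hK⟩) l
  · rintro w _ ⟨_, rfl⟩ K hK
    exact value_pathTree hd hA he hK (hpath w ⟨K, hK⟩)

end TreeOfCompactSet

end DigitSpace

theorem mainTheorem2 {X : Type*} [MetricSpace X] {k : ℕ} (d : Fin k → X → X) (u : ℕ → X)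
    (hX : DigitSpace.IsComputableDigitSpace d u)
    (hcov : DigitSpace.IsWellCovering d)
    (hdec : DigitSpace.IsDecidable d u)
    (hchoice : DigitSpace.HasApproximableChoice d u) :
    ∃ (H : DigitSpace.DigitalTree k → ℕ → List ℕ)
      (J : (ℕ → List ℕ) →. DigitSpace.DigitalTree k),
      DigitSpace.IsComputableOperator DigitSpace.DigitalTree.mem id
        (H : DigitSpace.DigitalTree k →. (ℕ → List ℕ)) ∧
      DigitSpace.IsComputableOperator id DigitSpace.DigitalTree.mem J ∧
      (∀ T, DigitSpace.HausdorffRep u (H T) (T.value d)) ∧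
      (∀ w, (J w).Dom ↔ ∃ K, DigitSpace.HausdorffRep u w K) ∧
      (∀ w, ∀ T ∈ J w, DigitSpace.HausdorffRep u w (T.value d)) ∧
      (∀ T, ∃ T' ∈ J (H T), T'.value d = T.value d) ∧
      (∀ w K, DigitSpace.HausdorffRep u w K →
        ∃ T ∈ J w, DigitSpace.HausdorffRep u (H T) K) := by
  obtain ⟨H, hHc, hH⟩ := DigitSpace.exists_hausdorff_operator hX
  obtain ⟨J, hJc, hJd, hJ⟩ := DigitSpace.exists_tree_operator hX hcov hdec hchoice
  refine ⟨H, J, hHc, hJc, hH, hJd, fun w T hT => ?_, fun T => ?_, fun w K hK => ?_⟩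
  · obtain ⟨K, hK⟩ := (hJd w).1 (Part.dom_iff_mem.2 ⟨T, hT⟩)
    rwa [hJ w T hT K hK]
  · obtain ⟨T', hT'⟩ := Part.dom_iff_mem.1 ((hJd (H T)).2 ⟨_, hH T⟩)
    exact ⟨T', hT', hJ _ T' hT' _ (hH T)⟩
  · obtain ⟨T, hT⟩ := Part.dom_iff_mem.1 ((hJd w).2 ⟨K, hK⟩)
    refine ⟨T, hT, ?_⟩
    rw [← hJ w T hT K hK]
    exact hH T
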